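/- Let $(R,\mathfrak m)$ be a commutative Noetherian local ring. For $R$-modules $M,N$ and $i\ge 0$ let $H^i_{\mathfrak m}(M,N)=\varinjlim_q \operatorname{Ext}^i_R(M/\mathfrak m^qM,N)$ be the $i$-th generalized local cohomology module, the direct system being induced by the natural maps $M/\mathfrak m^{q+1}M\to M/\mathfrak m^qM$, and let $\mathrm{cd}_R(M,N)=\sup\{i\ge 0 : H^i_{\mathfrak m}(M,N)\ne 0\}$. Put $e_R(M,N)=\sup\{i\ge 0 : \operatorname{Ext}^i_R(M,N)\ne 0\}$. Here $\sup\emptyset=-\infty$, and the zero module has dimension $-\infty$. A finitely generated $R$-module $C$ is semidualizing if the homothety map $R\to\operatorname{Hom}_R(C,C)$ is an isomorphism and $e_R(C,C)\le 0$ (that is, $\operatorname{Ext}^i_R(C,C)=0$ for all $i>0$). Write $M^C=\operatorname{Hom}_R(M,C)$. A finitely generated $R$-module $M$ is totally $C$-reflexive if the canonical biduality map $M\to M^{CC}$ is an isomorphism and $e_R(M,C)\le 0$ and $e_R(M^C,C)\le 0$ (that is, $\operatorname{Ext}^i_R(M,C)=\operatorname{Ext}^i_R(M^C,C)=0$ for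 all $i>0$). Let $C$ be a semidualizing $R$-module. Then for every totally $C$-reflexive $R$-module $M$, $$\mathrm{cd}_R(M,C)=\mathrm{cd}_R(M^C,C)=\dim_R M.$$ In particular, $\mathrm{cd}_R(C,C)=\dim R$. -/

import Mathlib

open CategoryTheory IsLocalRing

universe u

noncomputable section

namespace GenLocalCohomology

variable (R : Type u) [CommRing R]

/-- The module `Ext^i_R(M, N)`. -/
abbrev ExtMod (M N : Type u) [AddCommGroup M] [Module R M] [AddCommGroup N] [Module R N]
    (i : ℕ) : Type u :=
  Abelian.Ext.{u} (ModuleCat.of R M) (ModuleCat.of R N) i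

/-- The map `Ext^i_R(M', N) → Ext^i_R(M, N)` induced by a linear map `f : M → M'`. -/
def extMap {M M' : Type u} [AddCommGroup M] [Module R M] [AddCommGroup M'] [Module R M']
    (f : M →ₗ[R] M') (N : Type u) [AddCommGroup N] [Module R N] (i : ℕ) :
    ExtMod R M' N i →ₗ[R] ExtMod R M N i :=
  (Abelian.Ext.mk₀ (ModuleCat.ofHom f)).precompOfLinear R (ModuleCat.of R N) (zero_add i)

/-- The generalized local cohomology module `H^i_I(M, N)`: the direct limit over `q` of
`Ext^i_R(M / I^q M, N)`, with transition maps induced by the natural surjections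
`M / I^b M → M / I^a M` for `a ≤ b`. -/
abbrev genLocalCohomology (I : Ideal R) (M N : Type u) [AddCommGroup M] [Module R M]
    [AddCommGroup N] [Module R N] (i : ℕ) : Type u :=
  Module.DirectLimit (R := R) (ι := ℕ)
    (fun q => ExtMod R (M ⧸ (I ^ q • ⊤ : Submodule R M)) N i)
    (fun _ _ h => extMap R (Submodule.factorPow I M h) N i)

/-- The cohomological dimension `cd_I(M, N)` of the pair `M, N` with respect to `I`: the supremum
of the `i ≥ 0` with `H^i_I(M, N) ≠ 0`. The supremum of the empty set is `⊥`, that is `-∞`,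
in accordance with the dimension of the zero module. -/
def cd (I : Ideal R) (M N : Type u) [AddCommGroup M] [Module R M]
    [AddCommGroup N] [Module R N] : WithBot ℕ∞ :=
  sSup {x : WithBot ℕ∞ | ∃ i : ℕ, Nontrivial (genLocalCohomology R I M N i) ∧ x = i}

/-- The number `e_R(M, N)`: the supremum of the `i ≥ 0` with `Ext^i_R(M, N) ≠ 0`. -/
def extSup (M N : Type u) [AddCommGroup M] [Module R M]
    [AddCommGroup N] [Module R N] : WithBot ℕ∞ :=
  sSup {x : WithBot ℕ∞ | ∃ i : ℕ, Nontrivial (ExtMod R M N i) ∧ x = i}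

/-- A semidualizing module: `C` is finitely generated, the homothety map `R → Hom_R(C, C)` is an
isomorphism, and `Ext^i_R(C, C) = 0` for all `i > 0`. (The last condition is written
`extSup R C C ≤ 0`; it amounts to `extSup R C C = 0` as soon as `C ≠ 0`.) -/
structure IsSemidualizing (C : Type u) [AddCommGroup C] [Module R C] : Prop where
  finite : Module.Finite R C
  homothety_bijective : Function.Bijective (LinearMap.lsmul R C : R →ₗ[R] (C →ₗ[R] C))
  extSup_le : extSup R C C ≤ 0

/-- A totally `C`-reflexive module `M`, where `M^C = Hom_R(M, C)`: `M` is finitely generated, the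
biduality map `M → (M^C)^C`, `m ↦ (f ↦ f m)`, is an isomorphism, and
`Ext^i_R(M, C) = Ext^i_R(M^C, C) = 0` for all `i > 0`. (With `≤ 0` instead of `= 0` the zero module
is not excluded; for `M ≠ 0` the two versions agree, as then `M^C ≠ 0` and `M^CC ≠ 0`.) -/
structure IsTotallyReflexive (C M : Type u) [AddCommGroup C] [Module R C]
    [AddCommGroup M] [Module R M] : Prop where
  finite : Module.Finite R M
  biduality_bijective :
    Function.Bijective (LinearMap.applyₗ : M →ₗ[R] ((M →ₗ[R] C) →ₗ[R] C))
  extSup_le : extSup R M C ≤ 0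
  extSup_dual_le : extSup R (M →ₗ[R] C) C ≤ 0

end GenLocalCohomology

end

/-! Generalized local cohomology is reduced to ordinary local cohomology, which is the case of first
argument `R`. In degree 0, `H^0_I(M, N)` is the `I`-power torsion of `Hom(M, N)`. Embed `N` in an
injective `E`. If `Ext^j(M, N) = 0` for all `j > 0`, then `Hom(M, -)` keeps `0 → N → E → E/N → 0`
exact. By Artin–Rees, `Hom(M, E)` has no higher local cohomology. Dimension shifting then shows that
`H^i_I(M, N)` and `H^i_I(Hom(M, N))` vanish together (`subsingleton_iff_subsingleton_linearMap`).

Grothendieck's vanishing and non-vanishing theorems turn this into `cd(M, C) = dim Hom(M, C)`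
(`cd_eq_supportDim_linearMap`). Passing to `Hom(-, C)` does not raise the dimension, so `dim M = dim
M^CC ≤ dim M^C ≤ dim M` are equalities. For `M = C` one uses `Hom(C, C) ≅ R`.

Non-vanishing is proved by induction on dimension, in the stronger form that no power of `𝔪` kills
the top cohomology in positive degree (`not_exists_pow_smul_eq_zero`). The induction needs a regular
element that is also generic for an Artinian local cohomology module. Artinianness comes from
Melkersson's criterion, genericity from `exists_finite_primes_pow_smul_subset`. -/

noncomputable section

namespace GenLocalCohomology

variable {R : Type u} [CommRing R]

/-! ### Functoriality and the long exact sequence in the second argument -/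

section Functoriality

variable (I : Ideal R) (M : Type u) [AddCommGroup M] [Module R M]
variable {N N' N'' : Type u} [AddCommGroup N] [Module R N] [AddCommGroup N'] [Module R N']
  [AddCommGroup N''] [Module R N'']

lemma extMap_apply {M M' : Type u} [AddCommGroup M] [Module R M] [AddCommGroup M'] [Module R M']
    (f : M →ₗ[R] M') (N : Type u) [AddCommGroup N] [Module R N] (i : ℕ) (x : ExtMod R M' N i) :
    extMap R f N i x = (Abelian.Ext.mk₀ (ModuleCat.ofHom f)).comp x (zero_add i) := rfl

lemma extMap_id (M N : Type u) [AddCommGroup M] [Module R M] [AddCommGroup N] [Module R N] (i : ℕ)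
    (x : ExtMod R M N i) : extMap R LinearMap.id N i x = x :=
  Abelian.Ext.mk₀_id_comp x

lemma extMap_comp {M₁ M₂ M₃ : Type u} [AddCommGroup M₁] [Module R M₁] [AddCommGroup M₂]
    [Module R M₂] [AddCommGroup M₃] [Module R M₃] (f : M₁ →ₗ[R] M₂) (g : M₂ →ₗ[R] M₃)
    (N : Type u) [AddCommGroup N] [Module R N] (i : ℕ) (x : ExtMod R M₃ N i) :
    extMap R (g ∘ₗ f) N i x = extMap R f N i (extMap R g N i x) :=
  (Abelian.Ext.mk₀_comp_mk₀_assoc (ModuleCat.ofHom f) (ModuleCat.ofHom g) x).symm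

lemma factorPow_self (q : ℕ) : Submodule.factorPow I M (le_refl q) = LinearMap.id :=
  Submodule.linearMap_qext _ rfl

lemma factorPow_comp {a b c : ℕ} (hab : a ≤ b) (hbc : b ≤ c) :
    Submodule.factorPow I M hab ∘ₗ Submodule.factorPow I M hbc =
      Submodule.factorPow I M (hab.trans hbc) :=
  Submodule.factor_comp _ _

instance directedSystem_extMod (N : Type u) [AddCommGroup N] [Module R N] (i : ℕ) :
    DirectedSystem (fun q : ℕ => ExtMod R (M ⧸ (I ^ q • ⊤ : Submodule R M)) N i)
      (fun _ _ h => extMap R (Submodule.factorPow I M h) N i) where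
  map_self q x := (congrArg (fun f => extMap R f N i x) (factorPow_self I M q)).trans
    (extMap_id _ N i x)
  map_map _ _ _ hab hbc x := (extMap_comp _ _ N i x).symm.trans
    (congrArg (fun f => extMap R f N i x) (factorPow_comp I M hab hbc))

variable {I M} in
/-- The canonical map `Ext^i(M / I^q M, N) → H^i_I(M, N)`. -/
def ofExt {i : ℕ} (q : ℕ) :
    ExtMod R (M ⧸ (I ^ q • ⊤ : Submodule R M)) N i →ₗ[R] genLocalCohomology R I M N i :=
  Module.DirectLimit.of R ℕ (fun q : ℕ => ExtMod R (M ⧸ (I ^ q • ⊤ : Submodule R M)) N i)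
    (fun _ _ h => extMap R (Submodule.factorPow I M h) N i) q

/-- The map of direct limits induced by composition with an `Ext` class. -/
def postcompExt {n i j : ℕ} (β : ExtMod R N N' n) (h : i + n = j) :
    genLocalCohomology R I M N i →ₗ[R] genLocalCohomology R I M N' j :=
  Module.DirectLimit.map
    (G := fun q : ℕ => ExtMod R (M ⧸ (I ^ q • ⊤ : Submodule R M)) N i)
    (G' := fun q : ℕ => ExtMod R (M ⧸ (I ^ q • ⊤ : Submodule R M)) N' j)
    (fun q => β.postcompOfLinear R (ModuleCat.of R (M ⧸ (I ^ q • ⊤ : Submodule R M))) h) (by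
      intro a b hab
      ext x
      exact Abelian.Ext.comp_assoc (Abelian.Ext.mk₀ (ModuleCat.ofHom (Submodule.factorPow I M hab)))
        x β (zero_add i) h (by lia))

@[simp]
lemma postcompExt_of {n i j : ℕ} (β : ExtMod R N N' n) (h : i + n = j) (q : ℕ)
    (x : ExtMod R (M ⧸ (I ^ q • ⊤ : Submodule R M)) N i) :
    postcompExt I M β h (ofExt q x) = ofExt q (x.comp β h) := by
  rw [postcompExt, ofExt, Module.DirectLimit.map_apply_of]
  rfl

variable {I M} in
lemma ofExt_eq_zero {i q : ℕ} {x : ExtMod R (M ⧸ (I ^ q • ⊤ : Submodule R M)) N i}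
    (h : ofExt q x = 0) :
    ∃ (p : ℕ) (hp : q ≤ p), extMap R (Submodule.factorPow I M hp) N i x = 0 :=
  Module.DirectLimit.of.zero_exact
    (G := fun q : ℕ => ExtMod R (M ⧸ (I ^ q • ⊤ : Submodule R M)) N i)
    (f := fun _ _ h => extMap R (Submodule.factorPow I M h) N i) h

variable {I M} in
lemma ofExt_extMap {i q p : ℕ} (hp : q ≤ p)
    (x : ExtMod R (M ⧸ (I ^ q • ⊤ : Submodule R M)) N i) :
    ofExt p (extMap R (Submodule.factorPow I M hp) N i x) = ofExt q x :=
  Module.DirectLimit.of_f (G := fun q : ℕ => ExtMod R (M ⧸ (I ^ q • ⊤ : Submodule R M)) N i)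
    (f := fun _ _ h => extMap R (Submodule.factorPow I M h) N i)

variable {I M} in
lemma exists_ofExt {i : ℕ} (z : genLocalCohomology R I M N i) :
    ∃ (q : ℕ) (x : ExtMod R (M ⧸ (I ^ q • ⊤ : Submodule R M)) N i), ofExt q x = z :=
  Module.DirectLimit.exists_of z

/-- The map `H^i_I(M, N) → H^i_I(M, N')` induced by a linear map `N → N'`. -/
def map (f : N →ₗ[R] N') (i : ℕ) :
    genLocalCohomology R I M N i →ₗ[R] genLocalCohomology R I M N' i :=
  postcompExt I M (Abelian.Ext.mk₀ (ModuleCat.ofHom f)) (add_zero i)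

lemma map_ofExt (f : N →ₗ[R] N') (i q : ℕ)
    (x : ExtMod R (M ⧸ (I ^ q • ⊤ : Submodule R M)) N i) :
    map I M f i (ofExt q x) =
      ofExt q (x.comp (Abelian.Ext.mk₀ (ModuleCat.ofHom f)) (add_zero i)) :=
  postcompExt_of I M _ _ q x

/-- This makes multiplication by `r` a map of the long exact sequence of `0 → N → N → N/rN → 0`. -/
lemma map_smul_id (r : R) (i : ℕ) (z : genLocalCohomology R I M N i) :
    map I M (r • (LinearMap.id : N →ₗ[R] N)) i z = r • z := by
  obtain ⟨q, x, rfl⟩ := exists_ofExt z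
  have : ModuleCat.ofHom (r • (LinearMap.id : N →ₗ[R] N)) = r • 𝟙 (ModuleCat.of R N) := rfl
  rw [map_ofExt, this, Abelian.Ext.mk₀_smul, Abelian.Ext.comp_smul,
    Abelian.Ext.comp_mk₀_id, map_smul]

/-- A class coming from stage `q` is killed by `I ^ q`, because `M / I^q M` is. -/
lemma exists_pow_smul_eq_zero (i : ℕ) (z : genLocalCohomology R I M N i) :
    ∃ k : ℕ, ∀ a ∈ I ^ k, a • z = 0 := by
  obtain ⟨q, x, rfl⟩ := exists_ofExt z
  refine ⟨q, fun a ha => ?_⟩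
  have h0 : a • 𝟙 (ModuleCat.of R (M ⧸ (I ^ q • ⊤ : Submodule R M))) = 0 := by
    ext y
    exact (Submodule.Quotient.mk_eq_zero _).2 (Submodule.smul_mem_smul ha trivial)
  have : a • x = 0 := by
    rw [← Abelian.Ext.mk₀_id_comp x, ← Abelian.Ext.smul_comp, ← Abelian.Ext.mk₀_smul, h0,
      Abelian.Ext.mk₀_zero, Abelian.Ext.zero_comp]
  rw [← map_smul, this, map_zero]

/-- The short complex of module objects attached to an exact pair of linear maps. -/
abbrev shortComplex (f : N →ₗ[R] N') (g : N' →ₗ[R] N'') (hfg : Function.Exact f g) :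
    ShortComplex (ModuleCat.{u} R) :=
  ShortComplex.mk (ModuleCat.ofHom f) (ModuleCat.ofHom g) (by
    ext x
    exact hfg.apply_apply_eq_zero x)

variable {f : N →ₗ[R] N'} {g : N' →ₗ[R] N''}

lemma shortComplex_shortExact (hf : Function.Injective f) (hfg : Function.Exact f g)
    (hg : Function.Surjective g) : (shortComplex f g hfg).ShortExact where
  exact := (ShortComplex.ShortExact.moduleCat_exact_iff_function_exact _).2 hfg
  mono_f := (ModuleCat.mono_iff_injective _).2 hf
  epi_g := (ModuleCat.epi_iff_surjective _).2 hg

/-- The connecting homomorphism `H^i_I(M, N'') → H^{i+1}_I(M, N)`. -/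
def connecting (hf : Function.Injective f) (hfg : Function.Exact f g)
    (hg : Function.Surjective g) (i : ℕ) :
    genLocalCohomology R I M N'' i →ₗ[R] genLocalCohomology R I M N (i + 1) :=
  postcompExt I M (shortComplex_shortExact hf hfg hg).extClass rfl

variable (hf : Function.Injective f) (hfg : Function.Exact f g) (hg : Function.Surjective g)

lemma connecting_ofExt (i q : ℕ) (x : ExtMod R (M ⧸ (I ^ q • ⊤ : Submodule R M)) N'' i) :
    connecting I M hf hfg hg i (ofExt q x) =
      ofExt q (x.comp (shortComplex_shortExact hf hfg hg).extClass rfl) :=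
  postcompExt_of I M _ _ q x

-- Exactness passes to the limit: a relation in the limit already holds at some finite stage `p`,
-- where the `Ext` sequence supplies the preimage. The next two exactness lemmas work the same way.
include hf hfg hg in
lemma exact_map_map (i : ℕ) : Function.Exact (map I M f i) (map I M g i) := by
  have hS := shortComplex_shortExact hf hfg hg
  intro z
  constructor
  · intro hz
    obtain ⟨q, x, rfl⟩ := exists_ofExt z
    rw [map_ofExt] at hz
    obtain ⟨p, hp, h⟩ := ofExt_eq_zero hz
    rw [extMap_apply, ← Abelian.Ext.comp_assoc _ _ _ (zero_add i) _ (by lia)] at h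
    obtain ⟨y, hy⟩ := Abelian.Ext.covariant_sequence_exact₂ _ hS _ h
    refine ⟨ofExt p y, ?_⟩
    rw [map_ofExt]
    exact (congrArg (ofExt p) hy).trans (ofExt_extMap hp x)
  · rintro ⟨w, rfl⟩
    obtain ⟨q, x, rfl⟩ := exists_ofExt w
    rw [map_ofExt, map_ofExt,
      Abelian.Ext.comp_assoc _ _ _ _ (zero_add 0) (by lia), Abelian.Ext.mk₀_comp_mk₀,
      (shortComplex f g hfg).zero, Abelian.Ext.mk₀_zero, Abelian.Ext.comp_zero, map_zero]

lemma exact_map_connecting (i : ℕ) :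
    Function.Exact (map I M g i) (connecting I M hf hfg hg i) := by
  have hS := shortComplex_shortExact hf hfg hg
  intro z
  constructor
  · intro hz
    obtain ⟨q, x, rfl⟩ := exists_ofExt z
    rw [connecting_ofExt] at hz
    obtain ⟨p, hp, h⟩ := ofExt_eq_zero hz
    rw [extMap_apply, ← Abelian.Ext.comp_assoc _ _ _ (zero_add i) _ (by lia)] at h
    obtain ⟨y, hy⟩ := Abelian.Ext.covariant_sequence_exact₃ _ hS _ _ h
    refine ⟨ofExt p y, ?_⟩
    rw [map_ofExt]
    exact (congrArg (ofExt p) hy).trans (ofExt_extMap hp x)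
  · rintro ⟨w, rfl⟩
    obtain ⟨q, x, rfl⟩ := exists_ofExt w
    have h0 : (Abelian.Ext.mk₀ (ModuleCat.ofHom g)).comp hS.extClass (zero_add 1) = 0 :=
      hS.comp_extClass
    rw [map_ofExt, connecting_ofExt,
      Abelian.Ext.comp_assoc _ _ _ _ (zero_add 1) (by lia), h0, Abelian.Ext.comp_zero, map_zero]

lemma exact_connecting_map (i : ℕ) :
    Function.Exact (connecting I M hf hfg hg i) (map I M f (i + 1)) := by
  have hS := shortComplex_shortExact hf hfg hg
  intro z
  constructor
  · intro hz
    obtain ⟨q, x, rfl⟩ := exists_ofExt z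
    rw [map_ofExt] at hz
    obtain ⟨p, hp, h⟩ := ofExt_eq_zero hz
    rw [extMap_apply, ← Abelian.Ext.comp_assoc _ _ _ (zero_add _) _ (by lia)] at h
    obtain ⟨y, hy⟩ := Abelian.Ext.covariant_sequence_exact₁ _ hS _ h rfl
    refine ⟨ofExt p y, ?_⟩
    rw [connecting_ofExt]
    exact (congrArg (ofExt p) hy).trans (ofExt_extMap hp x)
  · rintro ⟨w, rfl⟩
    obtain ⟨q, x, rfl⟩ := exists_ofExt w
    have h0 : hS.extClass.comp (Abelian.Ext.mk₀ (ModuleCat.ofHom f)) (add_zero 1) = 0 :=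
      hS.extClass_comp
    rw [connecting_ofExt, map_ofExt,
      Abelian.Ext.comp_assoc _ _ _ _ (add_zero 1) (by lia), h0, Abelian.Ext.comp_zero, map_zero]

variable (N) in
lemma subsingleton_of_injective [Module.Injective R N] (i : ℕ) :
    Subsingleton (genLocalCohomology R I M N (i + 1)) := by
  have : Injective (ModuleCat.of R N) := Module.injective_object_of_injective_module R N
  refine ⟨fun z w => ?_⟩
  obtain ⟨q, x, rfl⟩ := exists_ofExt z
  obtain ⟨q, y, rfl⟩ := exists_ofExt w
  rw [x.eq_zero_of_injective, y.eq_zero_of_injective, map_zero, map_zero]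

lemma subsingleton_of_subsingleton [Subsingleton N] (i : ℕ) :
    Subsingleton (genLocalCohomology R I M N i) := by
  refine ⟨fun z w => ?_⟩
  rw [← one_smul R z, ← one_smul R w, ← map_smul_id, ← map_smul_id,
    Subsingleton.elim ((1 : R) • (LinearMap.id : N →ₗ[R] N)) 0]
  have h (v : genLocalCohomology R I M N i) : map I M (0 : N →ₗ[R] N) i v = 0 := by
    have := map_smul_id I M (N := N) 0 i v
    rwa [zero_smul, zero_smul] at this
  rw [h, h]

end Functoriality

/-! ### Degree zero as power-torsion homomorphisms -/

section DegreeZero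

variable (I : Ideal R) (M : Type u) [AddCommGroup M] [Module R M]
variable (N : Type u) {N' : Type u} [AddCommGroup N] [Module R N] [AddCommGroup N'] [Module R N']

/-- The map `Ext^0(M / I^q M, N) → Hom(M, N)`. -/
def extZeroToHom (q : ℕ) : ExtMod R (M ⧸ (I ^ q • ⊤ : Submodule R M)) N 0 →ₗ[R] (M →ₗ[R] N) :=
  (LinearMap.lcomp R N (Submodule.mkQ _)) ∘ₗ
    (ModuleCat.homLinearEquiv (S := R)).toLinearMap ∘ₗ
      (Abelian.Ext.linearEquiv₀ (R := R)).toLinearMap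

lemma extZeroToHom_mk₀ (q : ℕ) (φ : (M ⧸ (I ^ q • ⊤ : Submodule R M)) →ₗ[R] N) :
    extZeroToHom I M N q (Abelian.Ext.mk₀ (ModuleCat.ofHom φ)) = φ ∘ₗ Submodule.mkQ _ := by
  have h : Abelian.Ext.linearEquiv₀ (R := R) (Abelian.Ext.mk₀ (ModuleCat.ofHom φ)) =
      ModuleCat.ofHom φ :=
    (Abelian.Ext.linearEquiv₀ (R := R)).apply_symm_apply _
  rw [extZeroToHom, LinearMap.comp_apply, LinearMap.comp_apply, LinearEquiv.coe_coe,
    LinearEquiv.coe_coe, h]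
  rfl

variable {M N} in
lemma exists_mk₀ (x : ExtMod R M N 0) : ∃ φ : M →ₗ[R] N,
    Abelian.Ext.mk₀ (ModuleCat.ofHom φ) = x := by
  obtain ⟨φ, rfl⟩ := (Abelian.Ext.linearEquiv₀ (R := R)).symm.surjective x
  exact ⟨φ.hom, rfl⟩

/-- The canonical map `H^0_I(M, N) → Hom(M, N)`. -/
def toHom : genLocalCohomology R I M N 0 →ₗ[R] (M →ₗ[R] N) :=
  Module.DirectLimit.lift R ℕ (fun q : ℕ => ExtMod R (M ⧸ (I ^ q • ⊤ : Submodule R M)) N 0)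
    (fun _ _ h => extMap R (Submodule.factorPow I M h) N 0) (extZeroToHom I M N) (by
    intro a b hab x
    obtain ⟨φ, rfl⟩ := exists_mk₀ x
    rw [extMap_apply, Abelian.Ext.mk₀_comp_mk₀, ← ModuleCat.ofHom_comp, extZeroToHom_mk₀,
      extZeroToHom_mk₀, LinearMap.comp_assoc]
    congr 1)

@[simp]
lemma toHom_ofExt (q : ℕ) (φ : (M ⧸ (I ^ q • ⊤ : Submodule R M)) →ₗ[R] N) :
    toHom I M N (ofExt q (Abelian.Ext.mk₀ (ModuleCat.ofHom φ))) = φ ∘ₗ Submodule.mkQ _ :=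
  (Module.DirectLimit.lift_of _ _ _).trans (extZeroToHom_mk₀ I M N q φ)

variable {I M N} in
lemma exists_ofExt_mk₀ (z : genLocalCohomology R I M N 0) :
    ∃ (q : ℕ) (φ : (M ⧸ (I ^ q • ⊤ : Submodule R M)) →ₗ[R] N),
      ofExt q (Abelian.Ext.mk₀ (ModuleCat.ofHom φ)) = z := by
  obtain ⟨q, x, rfl⟩ := exists_ofExt z
  obtain ⟨φ, rfl⟩ := exists_mk₀ x
  exact ⟨q, φ, rfl⟩

lemma toHom_injective : Function.Injective (toHom I M N) := by
  refine (injective_iff_map_eq_zero _).2 fun z hz => ?_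
  obtain ⟨q, φ, rfl⟩ := exists_ofExt_mk₀ z
  rw [toHom_ofExt] at hz
  have : φ = 0 := by
    ext y
    exact LinearMap.congr_fun hz y
  rw [this, show ModuleCat.ofHom (0 : (M ⧸ (I ^ q • ⊤ : Submodule R M)) →ₗ[R] N) = 0 from rfl,
    Abelian.Ext.mk₀_zero, map_zero]

variable {N} in
lemma toHom_map (f : N →ₗ[R] N') (z : genLocalCohomology R I M N 0) :
    toHom I M N' (map I M f 0 z) = f ∘ₗ toHom I M N z := by
  obtain ⟨q, φ, rfl⟩ := exists_ofExt_mk₀ z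
  rw [map_ofExt, Abelian.Ext.mk₀_comp_mk₀, ← ModuleCat.ofHom_comp, toHom_ofExt,
    toHom_ofExt, LinearMap.comp_assoc]

/-- A map killed by `I ^ k` vanishes on `I^k M`, hence factors through `M / I^k M`. With
`toHom_injective` this identifies `H^0_I(M, N)` with the torsion of `Hom(M, N)`. -/
lemma mem_range_toHom_iff (f : M →ₗ[R] N) :
    (∃ z, toHom I M N z = f) ↔ ∃ k : ℕ, ∀ a ∈ I ^ k, a • f = 0 := by
  constructor
  · rintro ⟨z, rfl⟩
    obtain ⟨k, hk⟩ := exists_pow_smul_eq_zero I M 0 z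
    exact ⟨k, fun a ha => by rw [← map_smul, hk a ha, map_zero]⟩
  · rintro ⟨k, hk⟩
    have hle : (I ^ k • ⊤ : Submodule R M) ≤ LinearMap.ker f :=
      Submodule.smul_le.2 fun a ha y _ => by
        rw [LinearMap.mem_ker, map_smul]
        exact LinearMap.congr_fun (hk a ha) y
    refine ⟨ofExt k (Abelian.Ext.mk₀ (ModuleCat.ofHom ((I ^ k • ⊤ : Submodule R M).liftQ f hle))),
      ?_⟩
    rw [toHom_ofExt]
    exact Submodule.liftQ_mkQ _ _ _

/-- Surjectivity of the map in degree zero, in terms of `I`-power torsion homomorphisms. -/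
lemma map_zero_surjective_iff {N : Type u} [AddCommGroup N] [Module R N] (g : N →ₗ[R] N') :
    Function.Surjective (map I M g 0) ↔
      ∀ f : M →ₗ[R] N', (∃ k : ℕ, ∀ a ∈ I ^ k, a • f = 0) →
        ∃ h : M →ₗ[R] N, (∃ k : ℕ, ∀ a ∈ I ^ k, a • h = 0) ∧ g ∘ₗ h = f := by
  constructor
  · intro H f hf
    obtain ⟨z, rfl⟩ := (mem_range_toHom_iff I M N' f).2 hf
    obtain ⟨w, rfl⟩ := H z
    exact ⟨toHom I M N w, (mem_range_toHom_iff I M N _).1 ⟨w, rfl⟩, (toHom_map I M g w).symm⟩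
  · intro H z
    obtain ⟨h, hh, e⟩ := H _ ((mem_range_toHom_iff I M N' _).1 ⟨z, rfl⟩)
    obtain ⟨w, rfl⟩ := (mem_range_toHom_iff I M N h).2 hh
    exact ⟨w, toHom_injective I M N' ((toHom_map I M g w).trans e)⟩

lemma subsingleton_zero_iff :
    Subsingleton (genLocalCohomology R I M N 0) ↔
      ∀ f : M →ₗ[R] N, (∃ k : ℕ, ∀ a ∈ I ^ k, a • f = 0) → f = 0 := by
  constructor
  · intro H f hf
    obtain ⟨z, rfl⟩ := (mem_range_toHom_iff I M N f).2 hf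
    rw [Subsingleton.elim z 0, map_zero]
  · intro H
    refine subsingleton_of_forall_eq 0 fun z => toHom_injective I M N ?_
    rw [map_zero]
    exact H _ ((mem_range_toHom_iff I M N _).1 ⟨z, rfl⟩)

end DegreeZero

/-! ### The torsion functor and Artin–Rees -/

section PowTorsion

variable (I : Ideal R) (N : Type u) [AddCommGroup N] [Module R N]

/-- The submodule `Γ_I(N)` of elements annihilated by a power of `I`. -/
def powTorsion : Submodule R N where
  carrier := {x | ∃ k : ℕ, ∀ a ∈ I ^ k, a • x = 0}
  zero_mem' := ⟨0, fun a _ => smul_zero a⟩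
  add_mem' := by
    rintro x y ⟨k, hk⟩ ⟨l, hl⟩
    refine ⟨k + l, fun a ha => ?_⟩
    rw [smul_add, hk a (Ideal.pow_le_pow_right (Nat.le_add_right k l) ha),
      hl a (Ideal.pow_le_pow_right (Nat.le_add_left l k) ha), add_zero]
  smul_mem' := by
    rintro c x ⟨k, hk⟩
    exact ⟨k, fun a ha => by rw [smul_comm, hk a ha, smul_zero]⟩

variable {I N}

lemma map_mem_powTorsion {N' : Type u} [AddCommGroup N'] [Module R N'] (f : N →ₗ[R] N') {x : N}
    (hx : x ∈ powTorsion I N) : f x ∈ powTorsion I N' := by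
  obtain ⟨k, hk⟩ := hx
  exact ⟨k, fun a ha => by rw [← map_smul, hk a ha, map_zero]⟩

lemma exists_pow_smul_powTorsion_eq_zero {S : Submodule R N} (hS : S.FG)
    (h : S ≤ powTorsion I N) : ∃ k : ℕ, ∀ a ∈ I ^ k, ∀ x ∈ S, a • x = 0 := by
  induction S, hS using Submodule.fg_induction with
  | singleton x =>
    obtain ⟨k, hk⟩ := h (Submodule.mem_span_singleton_self x)
    refine ⟨k, fun a ha y hy => ?_⟩
    obtain ⟨c, rfl⟩ := Submodule.mem_span_singleton.1 hy
    rw [smul_comm, hk a ha, smul_zero]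
  | sup S T _ _ hS hT =>
    obtain ⟨k, hk⟩ := hS (le_sup_left.trans h)
    obtain ⟨l, hl⟩ := hT (le_sup_right.trans h)
    refine ⟨k + l, fun a ha x hx => ?_⟩
    obtain ⟨y, hy, z, hz, rfl⟩ := Submodule.mem_sup.1 hx
    rw [smul_add, hk a (Ideal.pow_le_pow_right (Nat.le_add_right k l) ha) y hy,
      hl a (Ideal.pow_le_pow_right (Nat.le_add_left l k) ha) z hz, add_zero]

lemma mem_powTorsion_linearMap {M : Type u} [AddCommGroup M] [Module R M] [Module.Finite R M]
    {f : M →ₗ[R] N} (h : ∀ x, f x ∈ powTorsion I N) : f ∈ powTorsion I (M →ₗ[R] N) := by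
  have hfg : (LinearMap.range f).FG := by
    rw [LinearMap.range_eq_map]
    exact Module.Finite.fg_top.map f
  obtain ⟨k, hk⟩ := exists_pow_smul_powTorsion_eq_zero hfg
    (by rintro _ ⟨x, rfl⟩; exact h x)
  exact ⟨k, fun a ha => LinearMap.ext fun x => hk a ha _ ⟨x, rfl⟩⟩

lemma smul_top_le_ker {M : Type u} [AddCommGroup M] [Module R M] {J : Ideal R} {f : M →ₗ[R] N}
    (h : ∀ a ∈ J, a • f = 0) : (J • ⊤ : Submodule R M) ≤ LinearMap.ker f :=
  Submodule.smul_le.2 fun a ha y _ => by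
    rw [LinearMap.mem_ker, map_smul]
    exact LinearMap.congr_fun (h a ha) y

/-- By the Artin–Rees lemma, an `I`-power torsion homomorphism into an injective module extends to
an `I`-power torsion homomorphism. -/
lemma exists_powTorsion_extension [IsNoetherianRing R] {L F E : Type u} [AddCommGroup L]
    [Module R L] [AddCommGroup F] [Module R F] [AddCommGroup E] [Module R E] [Module.Finite R F]
    [Module.Injective R E] {j : L →ₗ[R] F} (hj : Function.Injective j) {f : L →ₗ[R] E}
    (hf : f ∈ powTorsion I (L →ₗ[R] E)) :
    ∃ g ∈ powTorsion I (F →ₗ[R] E), g ∘ₗ j = f := by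
  obtain ⟨k, hk⟩ := hf
  -- `c` is the Artin–Rees constant of `j(L) ⊆ F`: it makes `f` vanish on the preimage of `I^(c+k)
  -- F`.
  obtain ⟨c, hc⟩ := Ideal.exists_pow_inf_eq_pow_smul I (LinearMap.range j)
  have hle : (I ^ (c + k) • ⊤ : Submodule R F) ⊓ LinearMap.range j ≤
      I ^ k • LinearMap.range j := by
    rw [hc (c + k) (Nat.le_add_right c k), Nat.add_sub_cancel_left]
    exact Submodule.smul_mono le_rfl inf_le_right
  set P : Submodule R F := I ^ (c + k) • ⊤ with hP
  have hker : P.comap j ≤ LinearMap.ker f := by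
    intro y hy
    have h1 : j y ∈ I ^ k • LinearMap.range j := hle ⟨hy, y, rfl⟩
    rw [LinearMap.range_eq_map, ← Submodule.map_smul''] at h1
    obtain ⟨z, hz, hzy⟩ := h1
    rw [← hj hzy]
    exact smul_top_le_ker hk hz
  -- Extending from `L / j⁻¹(P)` to `F / P`, rather than from `L` to `F`, forces the extension to be
  -- killed by `I^(c+k)`.
  have hinj : Function.Injective ((P.comap j).mapQ P j le_rfl) := by
    rw [← LinearMap.ker_eq_bot, Submodule.mapQ, Submodule.ker_liftQ, LinearMap.ker_comp,
      Submodule.ker_mkQ, Submodule.mkQ_map_self]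
  obtain ⟨h, hh⟩ := Module.Injective.extension_property R E _ _ _ hinj ((P.comap j).liftQ f hker)
  refine ⟨h ∘ₗ P.mkQ, ⟨c + k, fun a ha => ?_⟩, ?_⟩
  · ext y
    have : P.mkQ (a • y) = 0 := by
      rw [Submodule.mkQ_apply, Submodule.Quotient.mk_eq_zero]
      exact Submodule.smul_mem_smul ha trivial
    rw [LinearMap.smul_apply, LinearMap.comp_apply, ← map_smul, ← map_smul, this, map_zero,
      LinearMap.zero_apply]
  · ext y
    exact LinearMap.congr_fun hh (Submodule.Quotient.mk y)

/-- Baer's criterion: a map from an ideal to `Γ_I(N)` is torsion since the ideal is finitely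
generated, so it has a torsion extension to `R`, whose values lie in `Γ_I(N)`. -/
instance injective_powTorsion [IsNoetherianRing R] [Module.Injective R N] :
    Module.Injective R (powTorsion I N) := by
  refine Module.Baer.injective fun J g => ?_
  have : Module.Finite R J := inferInstance
  obtain ⟨h, ⟨k, hk⟩, hg⟩ := exists_powTorsion_extension (I := I) (j := J.subtype)
    J.subtype_injective (mem_powTorsion_linearMap
      (f := (powTorsion I N).subtype ∘ₗ g) fun x => (g x).2)
  refine ⟨h.codRestrict _ fun r => ⟨k, fun a ha => LinearMap.congr_fun (hk a ha) r⟩,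
    fun x hx => Subtype.ext (LinearMap.congr_fun hg ⟨x, hx⟩)⟩

variable (R N) in
lemma exists_injective_embedding : ∃ (E : Type u) (_ : AddCommGroup E) (_ : Module R E)
    (f : N →ₗ[R] E), Module.Injective R E ∧ Function.Injective f := by
  obtain ⟨⟨E, hE, f, hf⟩⟩ := EnoughInjectives.presentation (ModuleCat.of R N)
  exact ⟨E, inferInstance, inferInstance, f.hom,
    Module.injective_module_of_injective_object R E, (ModuleCat.mono_iff_injective _).1 hf⟩

end PowTorsion

/-! ### Dimension shifting -/

section DimensionShift

variable (I : Ideal R) (M : Type u) [AddCommGroup M] [Module R M]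
variable {N N' N'' : Type u} [AddCommGroup N] [Module R N] [AddCommGroup N'] [Module R N']
  [AddCommGroup N''] [Module R N'']
variable {f : N →ₗ[R] N'} {g : N' →ₗ[R] N''}
variable (hf : Function.Injective f) (hfg : Function.Exact f g) (hg : Function.Surjective g)

lemma connecting_surjective (i : ℕ) (h : Subsingleton (genLocalCohomology R I M N' (i + 1))) :
    Function.Surjective (connecting I M hf hfg hg i) :=
  fun z => (exact_connecting_map I M hf hfg hg i z).1 (Subsingleton.elim _ _)

lemma connecting_injective (i : ℕ) (h : Subsingleton (genLocalCohomology R I M N' i)) :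
    Function.Injective (connecting I M hf hfg hg i) := by
  refine (injective_iff_map_eq_zero _).2 fun z hz => ?_
  obtain ⟨w, rfl⟩ := (exact_map_connecting I M hf hfg hg i z).1 hz
  rw [Subsingleton.elim w 0, _root_.map_zero]

-- Used at `i = 0`, where the middle term may have nonzero cohomology and the connecting map need
-- not be injective.
include hf hfg hg in
lemma subsingleton_succ_iff_surjective (i : ℕ)
    (h : Subsingleton (genLocalCohomology R I M N' (i + 1))) :
    Subsingleton (genLocalCohomology R I M N (i + 1)) ↔ Function.Surjective (map I M g i) := by
  constructor
  · intro _ z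
    exact (exact_map_connecting I M hf hfg hg i z).1 (Subsingleton.elim _ _)
  · intro hs
    refine subsingleton_of_forall_eq 0 fun z => ?_
    obtain ⟨w, rfl⟩ := connecting_surjective I M hf hfg hg i h z
    exact (exact_map_connecting I M hf hfg hg i w).2 (hs w)

include hf hfg hg in
lemma subsingleton_succ_iff (i : ℕ) (h₀ : Subsingleton (genLocalCohomology R I M N' i))
    (h₁ : Subsingleton (genLocalCohomology R I M N' (i + 1))) :
    Subsingleton (genLocalCohomology R I M N (i + 1)) ↔
      Subsingleton (genLocalCohomology R I M N'' i) :=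
  ⟨fun _ => (connecting_injective I M hf hfg hg i h₀).subsingleton,
    fun _ => (connecting_surjective I M hf hfg hg i h₁).subsingleton⟩

lemma map_zero_surjective_iff_powTorsion :
    Function.Surjective (map I M g 0) ↔ ∀ y ∈ powTorsion I (M →ₗ[R] N''),
      ∃ x ∈ powTorsion I (M →ₗ[R] N'), g ∘ₗ x = y :=
  map_zero_surjective_iff I M g

lemma map_zero_surjective_iff_ring :
    Function.Surjective (map I R g 0) ↔ ∀ y ∈ powTorsion I N'', ∃ x ∈ powTorsion I N', g x = y := by
  rw [map_zero_surjective_iff_powTorsion]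
  constructor
  · intro h y hy
    obtain ⟨x, hx, e⟩ := h (LinearMap.toSpanSingleton R N'' y)
      (map_mem_powTorsion (LinearMap.ringLmapEquivSelf R R N'').symm.toLinearMap hy)
    refine ⟨x 1, map_mem_powTorsion (LinearMap.applyₗ (1 : R)) hx, ?_⟩
    rw [← LinearMap.comp_apply, e, LinearMap.toSpanSingleton_apply, one_smul]
  · intro h y hy
    obtain ⟨x, hx, e⟩ := h (y 1) (map_mem_powTorsion (LinearMap.applyₗ (1 : R)) hy)
    refine ⟨LinearMap.toSpanSingleton R N' x,
      (map_mem_powTorsion (LinearMap.ringLmapEquivSelf R R N').symm.toLinearMap hx), ?_⟩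
    ext
    simpa using e

variable (N) in
lemma subsingleton_zero_iff_powTorsion :
    Subsingleton (genLocalCohomology R I M N 0) ↔
      ∀ y ∈ powTorsion I (M →ₗ[R] N), y = 0 :=
  subsingleton_zero_iff I M N

variable (N) in
lemma subsingleton_zero_iff_ring :
    Subsingleton (genLocalCohomology R I R N 0) ↔ ∀ y ∈ powTorsion I N, y = 0 := by
  rw [subsingleton_zero_iff_powTorsion]
  constructor
  · intro h y hy
    have := h (LinearMap.toSpanSingleton R N y)
      (map_mem_powTorsion (LinearMap.ringLmapEquivSelf R R N).symm.toLinearMap hy)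
    simpa using LinearMap.congr_fun this 1
  · intro h y hy
    ext
    exact h (y 1) (map_mem_powTorsion (LinearMap.applyₗ (1 : R)) hy)

end DimensionShift

/-! ### Acyclic modules for local cohomology -/

section Acyclicity

variable (I : Ideal R) [IsNoetherianRing R]

/-- Modules of `I`-power torsion have no higher local cohomology. -/
lemma subsingleton_of_powTorsion (i : ℕ) (N : Type u) [AddCommGroup N] [Module R N]
    (hN : ∀ x : N, x ∈ powTorsion I N) : Subsingleton (genLocalCohomology R I R N (i + 1)) := by
  induction i using Nat.strong_induction_on generalizing N with | _ i ih =>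
  obtain ⟨E, _, _, f, hE, hf⟩ := exists_injective_embedding R N
  -- `Γ_I(E)` is both injective and torsion, so the cokernel is torsion again and the induction
  -- applies to it.
  let f' : N →ₗ[R] powTorsion I E := f.codRestrict _ fun x => map_mem_powTorsion f (hN x)
  have hf' : Function.Injective f' := fun x y h => hf (congrArg Subtype.val h)
  cases i with
  | zero =>
    rw [subsingleton_succ_iff_surjective I R hf' (LinearMap.exact_map_mkQ_range f')
      (Submodule.mkQ_surjective _) 0 (subsingleton_of_injective I R _ 0),
      map_zero_surjective_iff_ring]
    intro y _
    obtain ⟨⟨x, hx⟩, rfl⟩ := Submodule.mkQ_surjective _ y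
    obtain ⟨k, hk⟩ := hx
    exact ⟨⟨x, k, hk⟩, ⟨k, fun a ha => Subtype.ext (hk a ha)⟩, rfl⟩
  | succ i =>
    rw [subsingleton_succ_iff I R hf' (LinearMap.exact_map_mkQ_range f')
      (Submodule.mkQ_surjective _) (i + 1) (subsingleton_of_injective I R _ i)
      (subsingleton_of_injective I R _ (i + 1))]
    refine ih i i.lt_succ_self _ fun y => ?_
    obtain ⟨⟨x, hx⟩, rfl⟩ := Submodule.mkQ_surjective _ y
    obtain ⟨k, hk⟩ := hx
    exact map_mem_powTorsion _ ⟨k, fun a ha => Subtype.ext (hk a ha)⟩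

omit [IsNoetherianRing R] in
lemma injective_linearMap_pi (n : ℕ) (E : Type u) [AddCommGroup E] [Module R E]
    [Module.Injective R E] : Module.Injective R ((Fin n → R) →ₗ[R] E) :=
  (Module.Baer.of_equiv (Module.piEquiv (Fin n) R E)
    (Module.Baer.of_injective inferInstance)).injective

/-- Modules of homomorphisms from a finite module to an injective module have no higher local
cohomology. -/
lemma subsingleton_linearMap_injective (i : ℕ) (M E : Type u) [AddCommGroup M] [Module R M]
    [Module.Finite R M] [AddCommGroup E] [Module R E] [Module.Injective R E] :
    Subsingleton (genLocalCohomology R I R (M →ₗ[R] E) (i + 1)) := by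
  induction i using Nat.strong_induction_on generalizing M with | _ i ih =>
  -- Dualize `0 → ker p → R^n → M → 0` into `E`: the middle term becomes injective. Degree 1 is the
  -- torsion extension property, and higher degrees pass to `ker p`.
  obtain ⟨n, p, hp⟩ := Module.Finite.exists_fin' R M
  have := injective_linearMap_pi (R := R) n E
  have hinj : Function.Injective (LinearMap.lcomp R E p) := fun x y h => by
    ext z
    obtain ⟨w, rfl⟩ := hp z
    exact LinearMap.congr_fun h w
  have hsurj : Function.Surjective (LinearMap.lcomp R E (LinearMap.ker p).subtype) := fun y =>
    Module.Injective.extension_property R E _ _ _ (LinearMap.ker p).subtype_injective y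
  have hex : Function.Exact (LinearMap.lcomp R E p)
      (LinearMap.lcomp R E (LinearMap.ker p).subtype) :=
    LinearMap.exact_lcomp_of_exact_of_surjective E (LinearMap.exact_subtype_ker_map p) hp
  cases i with
  | zero =>
    rw [subsingleton_succ_iff_surjective I R hinj hex hsurj 0 (subsingleton_of_injective I R _ 0),
      map_zero_surjective_iff_ring]
    intro y hy
    exact exists_powTorsion_extension (LinearMap.ker p).subtype_injective hy
  | succ i =>
    rw [subsingleton_succ_iff I R hinj hex hsurj (i + 1) (subsingleton_of_injective I R _ i)
      (subsingleton_of_injective I R _ (i + 1))]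
    exact ih i i.lt_succ_self _

end Acyclicity

/-! ### Comparison with the local cohomology of `Hom(M, N)` -/

section Comparison

variable (I : Ideal R)

lemma exists_lift_of_subsingleton_ext {M N N' N'' : Type u} [AddCommGroup M] [Module R M]
    [AddCommGroup N] [Module R N] [AddCommGroup N'] [Module R N'] [AddCommGroup N'']
    [Module R N''] {f : N →ₗ[R] N'} {g : N' →ₗ[R] N''} (hf : Function.Injective f)
    (hfg : Function.Exact f g) (hg : Function.Surjective g) (h : Subsingleton (ExtMod R M N 1))
    (y : M →ₗ[R] N'') : ∃ x : M →ₗ[R] N', g ∘ₗ x = y := by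
  obtain ⟨x, hx⟩ := Abelian.Ext.covariant_sequence_exact₃ (ModuleCat.of R M)
    (shortComplex_shortExact hf hfg hg) (Abelian.Ext.mk₀ (ModuleCat.ofHom y)) (zero_add 1)
    (@Subsingleton.elim (ExtMod R M N 1) h _ _)
  obtain ⟨φ, rfl⟩ := exists_mk₀ x
  refine ⟨φ, ?_⟩
  have hx' := (Abelian.Ext.mk₀_comp_mk₀ (ModuleCat.ofHom φ) (ModuleCat.ofHom g)).symm.trans hx
  exact congrArg ModuleCat.Hom.hom ((Abelian.Ext.mk₀_bijective _ _).1 hx')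

lemma subsingleton_ext_of_injective {M N N' N'' : Type u} [AddCommGroup M] [Module R M]
    [AddCommGroup N] [Module R N] [AddCommGroup N'] [Module R N'] [AddCommGroup N'']
    [Module R N''] [Module.Injective R N'] {f : N →ₗ[R] N'} {g : N' →ₗ[R] N''}
    (hf : Function.Injective f)
    (hfg : Function.Exact f g) (hg : Function.Surjective g) (i : ℕ)
    (h : Subsingleton (ExtMod R M N (i + 2))) : Subsingleton (ExtMod R M N'' (i + 1)) := by
  have : Injective (ModuleCat.of R N') := Module.injective_object_of_injective_module R N'
  refine subsingleton_of_forall_eq 0 fun x => ?_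
  obtain ⟨y, hy⟩ := Abelian.Ext.covariant_sequence_exact₃ (ModuleCat.of R M)
    (shortComplex_shortExact hf hfg hg) x (by lia)
    (@Subsingleton.elim (ExtMod R M N (i + 2)) h _ _)
  rw [← hy, show y = 0 from Abelian.Ext.eq_zero_of_injective y, Abelian.Ext.zero_comp]

/-- If `Ext^j(M, N) = 0` for all `j > 0`, the vanishing of `H^i_I(M, N)` is equivalent to the
vanishing of the local cohomology module `H^i_I(Hom(M, N))`. -/
theorem subsingleton_iff_subsingleton_linearMap [IsNoetherianRing R] (M : Type u)
    [AddCommGroup M] [Module R M] [Module.Finite R M] (i : ℕ) (N : Type u) [AddCommGroup N] [Module R N]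
    (h : ∀ j : ℕ, Subsingleton (ExtMod R M N (j + 1))) :
    Subsingleton (genLocalCohomology R I M N i) ↔
      Subsingleton (genLocalCohomology R I R (M →ₗ[R] N) i) := by
  induction i generalizing N with
  | zero => rw [subsingleton_zero_iff_powTorsion, subsingleton_zero_iff_ring]
  | succ i ih =>
    obtain ⟨E, _, _, f, hE, hf⟩ := exists_injective_embedding R N
    have hfg := LinearMap.exact_map_mkQ_range f
    have hg := Submodule.mkQ_surjective (LinearMap.range f)
    set g := (LinearMap.range f).mkQ
    have hinj : Function.Injective (LinearMap.compRight R f (M := M)) := fun x y e => by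
      ext z
      exact hf (LinearMap.congr_fun e z)
    have hsurj : Function.Surjective (LinearMap.compRight R g (M := M)) :=
      exists_lift_of_subsingleton_ext hf hfg hg (h 0)
    have hex : Function.Exact (LinearMap.compRight R f (M := M))
        (LinearMap.compRight R g (M := M)) := by
      intro y
      constructor
      · intro hy
        choose x hx using fun m => (hfg (y m)).1 (LinearMap.congr_fun hy m)
        refine ⟨⟨⟨x, fun a b => hf ?_⟩, fun a b => hf ?_⟩, LinearMap.ext hx⟩
        · rw [hx, map_add, map_add, hx, hx]
        · simp [hx]
      · rintro ⟨x, rfl⟩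
        ext m
        exact hfg.apply_apply_eq_zero (x m)
    cases i with
    | zero =>
      -- Both sides say that every torsion map from `M` to the cokernel lifts to a torsion map from
      -- `M` to `E`.
      rw [subsingleton_succ_iff_surjective I M hf hfg hg 0 (subsingleton_of_injective I M E 0),
        subsingleton_succ_iff_surjective I R hinj hex hsurj 0
          (subsingleton_linearMap_injective I 0 M E),
        map_zero_surjective_iff_powTorsion, map_zero_surjective_iff_ring]
      rfl
    | succ i =>
      rw [subsingleton_succ_iff I M hf hfg hg (i + 1) (subsingleton_of_injective I M E i)
          (subsingleton_of_injective I M E (i + 1)),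
        subsingleton_succ_iff I R hinj hex hsurj (i + 1)
          (subsingleton_linearMap_injective I i M E)
          (subsingleton_linearMap_injective I (i + 1) M E)]
      exact ih _ fun j => subsingleton_ext_of_injective hf hfg hg j (h (j + 1))

end Comparison

/-! ### Artinian modules: Melkersson's criterion and generic scalars -/

section Artinian

variable {A : Type u} [AddCommGroup A] [Module R A]

/-- The submodule `x ^ j L ∩ (0 : x)` of the `x`-torsion `(0 : x)` of `A`. -/
def powTrace (x : R) (L : Submodule R A) (j : ℕ) : Submodule R (Submodule.torsionBy R A x) :=
  (L.map (LinearMap.lsmul R A (x ^ j))).comap (Submodule.subtype _)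

lemma powTrace_antitone (x : R) {L L' : Submodule R A} (hL : L ≤ L') {i j : ℕ} (hij : i ≤ j) :
    powTrace x L j ≤ powTrace x L' i := by
  rintro t ⟨y, hy, hyt⟩
  refine ⟨x ^ (j - i) • y, L'.smul_mem _ (hL hy), ?_⟩
  rw [← hyt, LinearMap.lsmul_apply, LinearMap.lsmul_apply, smul_smul, ← pow_add,
    Nat.add_sub_cancel' hij]

/-- If `x^(n+1)` kills `y ∈ L'`, then `x^n y` is a trace of `L'`, hence equals `x^n z` with `z ∈ L`.
Now `x^n` kills `y - z`, and one inducts on `n`. -/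
lemma le_of_powTrace_le {x : R} (hx : ∀ y : A, ∃ n : ℕ, x ^ n • y = 0) {L L' : Submodule R A}
    (hL : L ≤ L') (h : ∀ j, powTrace x L' j ≤ powTrace x L j) : L' ≤ L := by
  have key : ∀ (n : ℕ) (y : A), y ∈ L' → x ^ n • y = 0 → y ∈ L := by
    intro n
    induction n with
    | zero =>
      intro y _ h0
      rw [pow_zero, one_smul] at h0
      exact h0 ▸ L.zero_mem
    | succ n ih =>
      intro y hy h0
      have ht : x ^ n • y ∈ Submodule.torsionBy R A x := by
        rw [Submodule.mem_torsionBy_iff, smul_smul, ← pow_succ']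
        exact h0
      obtain ⟨z, hz, hzy⟩ := h n (x := ⟨_, ht⟩) ⟨y, hy, rfl⟩
      have hzy' : x ^ n • z = x ^ n • y := hzy
      have := ih (y - z) (L'.sub_mem hy (hL hz)) (by rw [smul_sub, hzy', sub_self])
      simpa using L.add_mem this hz
  intro y hy
  obtain ⟨n, hn⟩ := hx y
  exact key n y hy hn

/-- **Melkersson's criterion**: a module all of whose elements are killed by a power of `x` is
Artinian as soon as its `x`-torsion is. -/
theorem isArtinian_of_torsionBy {x : R} (hx : ∀ y : A, ∃ n : ℕ, x ^ n • y = 0)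
    (h : IsArtinian R (Submodule.torsionBy R A x)) : IsArtinian R A := by
  rw [← monotone_stabilizes_iff_artinian]
  intro f
  have hf {a b : ℕ} (hab : a ≤ b) : (OrderDual.ofDual (f b)) ≤ OrderDual.ofDual (f a) :=
    f.monotone hab
  -- The diagonal chain, with exponent equal to the index, controls all exponents `j ≥ n₀` at once.
  -- The finitely many `j < n₀` are stabilized one at a time.
  obtain ⟨n₀, hn₀⟩ := IsArtinian.monotone_stabilizes (R := R)
    (⟨fun n => OrderDual.toDual (powTrace x (OrderDual.ofDual (f n)) n),
      fun a b hab => powTrace_antitone x (hf hab) hab⟩ : ℕ →o (Submodule R _)ᵒᵈ)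
  have hj (j : ℕ) := IsArtinian.monotone_stabilizes (R := R)
    (⟨fun n => OrderDual.toDual (powTrace x (OrderDual.ofDual (f n)) j),
      fun a b hab => powTrace_antitone x (hf hab) le_rfl⟩ : ℕ →o (Submodule R _)ᵒᵈ)
  choose m hm using hj
  have hn₀' : ∀ n, n₀ ≤ n → powTrace x (OrderDual.ofDual (f n₀)) n₀ =
      powTrace x (OrderDual.ofDual (f n)) n := hn₀
  have hm' : ∀ j n, m j ≤ n → powTrace x (OrderDual.ofDual (f (m j))) j =
      powTrace x (OrderDual.ofDual (f n)) j := hm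
  refine ⟨n₀ + (Finset.range n₀).sup m, fun n hn => ?_⟩
  refine le_antisymm (a := OrderDual.ofDual (f _)) ?_ (hf hn)
  refine le_of_powTrace_le hx (hf hn) fun j => ?_
  rcases lt_or_ge j n₀ with hlt | hge
  · have hle : m j ≤ n₀ + (Finset.range n₀).sup m :=
      (Finset.le_sup (Finset.mem_range.2 hlt)).trans (Nat.le_add_left _ _)
    exact ((hm' j _ hle).symm.trans (hm' j n (hle.trans hn))).le
  · refine (powTrace_antitone x (hf (Nat.le_add_right n₀ _)) hge).trans ?_
    refine (hn₀' (max n j) (hge.trans (le_max_right _ _))).le.trans ?_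
    exact powTrace_antitone x (hf (le_max_left _ _)) (le_max_right _ _)

/-- In an Artinian module which is not the sum of two proper submodules, every scalar acts
nilpotently or surjectively. -/
lemma mem_radical_annihilator_or_surjective [IsArtinian R A]
    (hA : ∀ V W : Submodule R A, V ⊔ W = ⊤ → V = ⊤ ∨ W = ⊤) (a : R) :
    a ∈ (Module.annihilator R A).radical ∨ ∀ y : A, ∃ z, a • z = y := by
  -- Fitting: kernel and image of a high power of `a` span `A`. The exponent `n + 1` used below is
  -- positive, so surjectivity of that power gives surjectivity of `a`.
  obtain ⟨n, hn⟩ := (LinearMap.eventually_codisjoint_ker_pow_range_pow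
    (LinearMap.lsmul R A a : Module.End R A)).exists_forall_of_atTop
  have key : ∀ (n : ℕ) (y : A), ((LinearMap.lsmul R A a : Module.End R A) ^ n) y = a ^ n • y := by
    intro n y
    rw [Module.End.pow_apply]
    exact smul_iterate_apply a n y
  rcases hA _ _ (codisjoint_iff.1 (hn (n + 1) n.le_succ)) with h | h
  · refine Or.inl ⟨n + 1, Module.mem_annihilator.2 fun y => ?_⟩
    rw [← key]
    exact LinearMap.mem_ker.1 (h ▸ Submodule.mem_top)
  · refine Or.inr fun y => ?_
    obtain ⟨z, hz⟩ := LinearMap.mem_range.1 (h ▸ Submodule.mem_top (x := y))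
    rw [key, pow_succ', mul_smul] at hz
    exact ⟨_, hz⟩

/-- A substitute for the finiteness of the set of attached primes of an Artinian module `A`: away
from finitely many primes different from `I`, every scalar `r` satisfies `I ^ j A ⊆ r A` for some
`j`. -/
theorem exists_finite_primes_pow_smul_subset [IsNoetherianRing R] [IsArtinian R A] (I : Ideal R) :
    ∃ S : Set (Ideal R), S.Finite ∧ (∀ p ∈ S, p.IsPrime ∧ p ≠ I) ∧
      ∀ r : R, (∀ p ∈ S, r ∉ p) → ∃ j : ℕ, ∀ a ∈ I ^ j, ∀ y : A, ∃ z : A, a • y = r • z := by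
  suffices H : ∀ U : Submodule R A, ∃ S : Set (Ideal R), S.Finite ∧
      (∀ p ∈ S, p.IsPrime ∧ p ≠ I) ∧ ∀ r : R, (∀ p ∈ S, r ∉ p) →
        ∃ j : ℕ, ∀ a ∈ I ^ j, ∀ y ∈ U, ∃ z ∈ U, a • y = r • z by
    obtain ⟨S, hS, hp, h⟩ := H ⊤
    refine ⟨S, hS, hp, fun r hr => ?_⟩
    obtain ⟨j, hj⟩ := h r hr
    refine ⟨j, fun a ha y => ?_⟩
    obtain ⟨z, -, hz⟩ := hj a ha y trivial
    exact ⟨z, hz⟩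
  intro U
  induction U using IsArtinian.induction with | _ U ih =>
  -- A sum-irreducible `U` contributes at most the prime `rad (Ann U)`; any other `U` is a sum of
  -- two smaller submodules.
  by_cases hU : ∀ V W : Submodule R A, V ⊔ W = U → V = U ∨ W = U
  · have hU' : ∀ V W : Submodule R U, V ⊔ W = ⊤ → V = ⊤ ∨ W = ⊤ := by
      intro V W hVW
      have hmap := congrArg (Submodule.map U.subtype) hVW
      rw [Submodule.map_sup, Submodule.map_subtype_top] at hmap
      rcases hU _ _ hmap with h | h
      · exact Or.inl (Submodule.map_injective_of_injective U.subtype_injective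
          (h.trans (Submodule.map_subtype_top U).symm))
      · exact Or.inr (Submodule.map_injective_of_injective U.subtype_injective
          (h.trans (Submodule.map_subtype_top U).symm))
    have hdich := mem_radical_annihilator_or_surjective hU'
    set p := (Module.annihilator R U).radical with hpdef
    -- Here a power of `I` kills `U`, so no prime is needed. This includes `U = 0`, where `p` is the
    -- unit ideal.
    by_cases hpI : I ≤ p
    · refine ⟨∅, Set.finite_empty, by simp, fun r _ => ?_⟩
      obtain ⟨j, hj⟩ := Ideal.exists_pow_le_of_le_radical_of_fg hpI (IsNoetherian.noetherian I)
      refine ⟨j, fun a ha y hy => ⟨0, U.zero_mem, ?_⟩⟩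
      rw [smul_zero]
      exact congrArg Subtype.val (Module.mem_annihilator.1 (hj ha) ⟨y, hy⟩)
    · have hprime : p.IsPrime := by
        refine ⟨fun h => hpI (h ▸ le_top), fun {a b} hab => ?_⟩
        refine or_iff_not_imp_left.2 fun ha => ?_
        have hsurj := (hdich a).resolve_left ha
        have hsurj' : ∀ (n : ℕ) (y : U), ∃ z, a ^ n • z = y := by
          intro n
          induction n with
          | zero => exact fun y => ⟨y, by simp⟩
          | succ n ihn =>
            intro y
            obtain ⟨z, rfl⟩ := ihn y
            obtain ⟨w, rfl⟩ := hsurj z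
            exact ⟨w, by rw [pow_succ, mul_smul]⟩
        obtain ⟨n, hn⟩ := hab
        refine ⟨n, Module.mem_annihilator.2 fun y => ?_⟩
        obtain ⟨z, rfl⟩ := hsurj' n y
        rw [smul_smul, mul_comm, ← mul_pow]
        exact Module.mem_annihilator.1 hn z
      refine ⟨{p}, Set.finite_singleton p, ?_, fun r hr => ⟨0, fun a _ y hy => ?_⟩⟩
      · rintro _ rfl
        exact ⟨hprime, fun h => hpI h.ge⟩
      · obtain ⟨z, hz⟩ := (hdich r).resolve_left (hr p rfl) (a • ⟨y, hy⟩)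
        exact ⟨z, z.2, (congrArg Subtype.val hz).symm⟩
  · push Not at hU
    obtain ⟨V, W, hVW, hV, hW⟩ := hU
    obtain ⟨S, hS, hSp, hSr⟩ := ih V (lt_of_le_of_ne (hVW ▸ le_sup_left) hV)
    obtain ⟨T, hT, hTp, hTr⟩ := ih W (lt_of_le_of_ne (hVW ▸ le_sup_right) hW)
    refine ⟨S ∪ T, hS.union hT, fun p hp => hp.elim (hSp p) (hTp p), fun r hr => ?_⟩
    obtain ⟨i, hi⟩ := hSr r fun p hp => hr p (Or.inl hp)
    obtain ⟨j, hj⟩ := hTr r fun p hp => hr p (Or.inr hp)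
    refine ⟨i + j, fun a ha y hy => ?_⟩
    obtain ⟨v, hv, w, hw, rfl⟩ := Submodule.mem_sup.1 (hVW ▸ hy)
    obtain ⟨v', hv', e⟩ := hi a (Ideal.pow_le_pow_right (Nat.le_add_right i j) ha) v hv
    obtain ⟨w', hw', e'⟩ := hj a (Ideal.pow_le_pow_right (Nat.le_add_left j i) ha) w hw
    exact ⟨v' + w', hVW ▸ Submodule.add_mem_sup hv' hw', by rw [smul_add, smul_add, e, e']⟩

/-- A finite module annihilated by a power of the maximal ideal is Artinian. -/
lemma isArtinian_of_maximalIdeal_pow_smul [IsNoetherianRing R] [IsLocalRing R] (k : ℕ)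
    (N : Type u) [AddCommGroup N] [Module R N] [Module.Finite R N]
    (h : ∀ a ∈ maximalIdeal R ^ k, ∀ x : N, a • x = 0) : IsArtinian R N := by
  induction k generalizing N with
  | zero =>
    have : Subsingleton N := subsingleton_of_forall_eq 0 fun x => by
      simpa using h 1 (by simp) x
    infer_instance
  | succ k ih =>
    rw [isArtinian_iff_submodule_quotient (maximalIdeal R • ⊤ : Submodule R N)]
    constructor
    · refine ih _ fun a ha x => Subtype.ext ?_
      have hle : (maximalIdeal R • ⊤ : Submodule R N) ≤ LinearMap.ker (LinearMap.lsmul R N a) :=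
        Submodule.smul_le.2 fun b hb y _ => by
          rw [LinearMap.mem_ker, LinearMap.lsmul_apply, smul_smul]
          exact h _ (by rw [pow_succ]; exact Ideal.mul_mem_mul ha hb) y
      exact hle x.2
    · let _ : Field (R ⧸ maximalIdeal R) := Ideal.Quotient.field _
      have : Module.Finite (R ⧸ maximalIdeal R) (N ⧸ (maximalIdeal R • ⊤ : Submodule R N)) :=
        Module.Finite.of_restrictScalars_finite R _ _
      have : IsArtinian (R ⧸ maximalIdeal R) (N ⧸ (maximalIdeal R • ⊤ : Submodule R N)) :=
        inferInstance
      exact isArtinian_of_surjective_algebraMap (R := R ⧸ maximalIdeal R) (S := R)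
        Ideal.Quotient.mk_surjective

end Artinian

/-! ### Passing to the torsion-free quotient -/

section TorsionFreeQuotient

variable (I : Ideal R) (N : Type u) [AddCommGroup N] [Module R N]

lemma exact_powTorsion_mkQ :
    Function.Exact (powTorsion I N).subtype (powTorsion I N).mkQ :=
  LinearMap.exact_subtype_mkQ _

lemma mem_powTorsion_powTorsion (x : powTorsion I N) : x ∈ powTorsion I (powTorsion I N) := by
  obtain ⟨x, k, hk⟩ := x
  exact ⟨k, fun a ha => Subtype.ext (hk a ha)⟩

variable {I N} in
lemma smul_eq_zero_of_mem_pow_add {x : N} {k l : ℕ}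
    (h : ∀ a ∈ I ^ k, ∀ b ∈ I ^ l, (a * b) • x = 0) : ∀ c ∈ I ^ (k + l), c • x = 0 := by
  intro c hc
  rw [pow_add] at hc
  have hle : I ^ k * I ^ l ≤ LinearMap.ker (LinearMap.toSpanSingleton R N x) :=
    Ideal.mul_le.2 fun a ha b hb => h a ha b hb
  exact hle hc

variable [IsNoetherianRing R]

lemma powTorsion_quotient_eq_zero [Module.Finite R N] (y : N ⧸ powTorsion I N)
    (hy : y ∈ powTorsion I (N ⧸ powTorsion I N)) : y = 0 := by
  obtain ⟨x, rfl⟩ := Submodule.mkQ_surjective _ y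
  obtain ⟨k, hk⟩ := hy
  obtain ⟨l, hl⟩ := exists_pow_smul_powTorsion_eq_zero (I := I)
    (IsNoetherian.noetherian (powTorsion I N)) le_rfl
  refine (Submodule.Quotient.mk_eq_zero _).2 ⟨l + k, ?_⟩
  refine smul_eq_zero_of_mem_pow_add fun a ha b hb => ?_
  rw [mul_smul]
  refine hl a ha _ ?_
  have := hk b hb
  rwa [← map_smul, Submodule.mkQ_apply, Submodule.Quotient.mk_eq_zero] at this

/-- `Γ_I(N)` is acyclic in positive degrees, so `N` may be replaced there by `N / Γ_I(N)`. In the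
finite local case the quotient has a regular element in `𝔪`. -/
lemma map_mkQ_injective (i : ℕ) :
    Function.Injective (map I R (powTorsion I N).mkQ (i + 1)) := by
  have := subsingleton_of_powTorsion I i _ (mem_powTorsion_powTorsion I N)
  refine (injective_iff_map_eq_zero _).2 fun z hz => ?_
  obtain ⟨w, rfl⟩ := (exact_map_map I R (powTorsion I N).subtype_injective
    (exact_powTorsion_mkQ I N) (Submodule.mkQ_surjective _) (i + 1) z).1 hz
  rw [Subsingleton.elim w 0, _root_.map_zero]

lemma map_mkQ_surjective (i : ℕ) : Function.Surjective (map I R (powTorsion I N).mkQ i) := by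
  have := subsingleton_of_powTorsion I i _ (mem_powTorsion_powTorsion I N)
  exact fun z => (exact_map_connecting I R (powTorsion I N).subtype_injective
    (exact_powTorsion_mkQ I N) (Submodule.mkQ_surjective _) i z).1 (Subsingleton.elim _ _)

end TorsionFreeQuotient

/-! ### The exact sequence of a regular element -/

section SMulRegular

open scoped Pointwise

variable {N : Type u} [AddCommGroup N] [Module R N] {r : R}

lemma smul_id_injective (hr : IsSMulRegular N r) :
    Function.Injective (r • (LinearMap.id : N →ₗ[R] N)) := hr

variable (N r) in
lemma exact_smul_id_mkQ : Function.Exact (r • (LinearMap.id : N →ₗ[R] N))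
    (r • ⊤ : Submodule R N).mkQ := by
  intro x
  rw [Submodule.mkQ_apply, Submodule.Quotient.mk_eq_zero, Submodule.mem_smul_pointwise_iff_exists]
  simp

end SMulRegular

lemma eq_natCast_of_add_one_eq {x : WithBot ℕ∞} {n : ℕ} (h : x + 1 = (n + 1 : ℕ)) : x = n := by
  induction x using WithBot.recBotCoe with
  | bot => exact absurd h.symm WithBot.coe_ne_bot
  | coe d =>
    have h' : d + 1 = (n : ℕ∞) + 1 := WithBot.coe_injective h
    exact congrArg _ (WithTop.add_right_cancel WithTop.one_ne_top h')

/-! ### Finite modules over a local ring: Artinianness and Grothendieck's theorems -/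

section Local

open scoped Pointwise

variable [IsNoetherianRing R] [IsLocalRing R]
variable (N : Type u) [AddCommGroup N] [Module R N] [Module.Finite R N]

variable {N} in
/-- Prime avoidance for modules without `𝔪`-power torsion. -/
lemma exists_isSMulRegular_notMem (hN : ∀ x ∈ powTorsion (maximalIdeal R) N, x = 0)
    {S : Set (Ideal R)} (hS : S.Finite) (hp : ∀ p ∈ S, p.IsPrime ∧ p ≠ maximalIdeal R) :
    ∃ r ∈ maximalIdeal R, IsSMulRegular N r ∧ ∀ p ∈ S, r ∉ p := by
  by_contra! H
  have hfin : (S ∪ associatedPrimes R N).Finite := hS.union (associatedPrimes.finite R N)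
  have hprime : ∀ p ∈ S ∪ associatedPrimes R N, p.IsPrime :=
    fun p h => h.elim (fun h => (hp p h).1) fun h => h.isPrime
  -- The two indices allowed to be non-prime are dummies, since every ideal here is prime.
  obtain ⟨p, hpS, hle⟩ := (Ideal.subset_union_prime_finite hfin (f := id) (I := maximalIdeal R)
    ⊥ ⊥ fun p h _ _ => hprime p h).1 (by
      intro r hr
      by_cases hreg : IsSMulRegular N r
      · obtain ⟨p, hpS, hrp⟩ := H r hr hreg
        exact Set.mem_biUnion (Or.inl hpS) hrp
      · have : r ∈ ⋃ p ∈ associatedPrimes R N, (p : Set R) := by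
          rw [biUnion_associatedPrimes_eq_compl_regular R N]
          exact hreg
        obtain ⟨p, hp', hrp⟩ := Set.mem_iUnion₂.1 this
        exact Set.mem_biUnion (Or.inr hp') hrp)
  have heq : maximalIdeal R = p :=
    (maximalIdeal.isMaximal R).eq_of_le (hprime p hpS).ne_top hle
  rcases hpS with h | h
  · exact (hp p h).2 heq.symm
  · obtain ⟨hpr, x, hx⟩ := isAssociatedPrime_iff.1 h
    have hx0 : x = 0 := hN x ⟨1, fun a ha => by
      rw [pow_one, heq, hx] at ha
      exact Submodule.mem_colon_singleton.1 ha⟩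
    refine hpr.ne_top (hx.trans ?_)
    rw [hx0]
    simp

/-- The local cohomology modules of a finite module are Artinian. -/
theorem isArtinian_genLocalCohomology (i : ℕ) :
    IsArtinian R (genLocalCohomology R (maximalIdeal R) R N i) := by
  induction i generalizing N with
  | zero =>
    obtain ⟨k, hk⟩ := exists_pow_smul_powTorsion_eq_zero (I := maximalIdeal R)
      (IsNoetherian.noetherian (powTorsion (maximalIdeal R) N)) le_rfl
    have := isArtinian_of_maximalIdeal_pow_smul k (powTorsion (maximalIdeal R) N)
      fun a ha x => Subtype.ext (hk a ha x x.2)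
    refine isArtinian_of_injective
      (LinearMap.codRestrict (powTorsion (maximalIdeal R) N)
        (LinearMap.applyₗ (1 : R) ∘ₗ toHom (maximalIdeal R) R N) fun z => ?_) ?_
    · obtain ⟨k, hk⟩ := exists_pow_smul_eq_zero _ _ _ z
      exact map_mem_powTorsion _ ⟨k, hk⟩
    · intro z w h
      exact toHom_injective _ _ _ (LinearMap.ext_ring (congrArg Subtype.val h))
  | succ i ih =>
    suffices H : ∀ (N : Type u) [AddCommGroup N] [Module R N] [Module.Finite R N],
        (∀ x ∈ powTorsion (maximalIdeal R) N, x = 0) →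
        IsArtinian R (genLocalCohomology R (maximalIdeal R) R N (i + 1)) by
      have := H (N ⧸ powTorsion (maximalIdeal R) N)
        (powTorsion_quotient_eq_zero (maximalIdeal R) N)
      exact isArtinian_of_injective _ (map_mkQ_injective (maximalIdeal R) N i)
    intro N _ _ _ hN
    obtain ⟨r, hr, hreg, -⟩ := exists_isSMulRegular_notMem hN Set.finite_empty (by simp)
    have hA := ih (QuotSMulTop r N)
    -- The `r`-torsion of `H^{i+1}(N)` lies in the image of the Artinian module `H^i(N/rN)`.
    refine isArtinian_of_torsionBy (x := r) (fun y => ?_) ?_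
    · obtain ⟨k, hk⟩ := exists_pow_smul_eq_zero _ _ _ y
      exact ⟨k, hk _ (Ideal.pow_mem_pow hr k)⟩
    · have hle : Submodule.torsionBy R _ r ≤ LinearMap.range (connecting (maximalIdeal R) R
          (smul_id_injective hreg) (exact_smul_id_mkQ N r) (Submodule.mkQ_surjective _) i) := by
        intro z hz
        refine (exact_connecting_map _ _ (smul_id_injective hreg) (exact_smul_id_mkQ N r)
          (Submodule.mkQ_surjective _) i z).1 ?_
        rw [map_smul_id]
        exact (Submodule.mem_torsionBy_iff r z).1 hz
      exact isArtinian_of_le hle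

/-- **Grothendieck's vanishing theorem** for finite modules over a local ring. -/
theorem subsingleton_of_supportDim_lt (n : ℕ) (hn : Module.supportDim R N < n) (i : ℕ)
    (hi : n ≤ i) : Subsingleton (genLocalCohomology R (maximalIdeal R) R N i) := by
  induction n generalizing N i with
  | zero =>
    have : Subsingleton N := by
      by_contra h
      rw [not_subsingleton_iff_nontrivial] at h
      have h0 := (Module.supportDim_ne_bot_iff_nontrivial R N).2 h
      obtain ⟨d, hd⟩ := WithBot.ne_bot_iff_exists.1 h0
      rw [← hd] at hn
      have h1 : d < 0 := WithBot.coe_lt_coe.1 hn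
      exact not_lt_zero h1
    exact subsingleton_of_subsingleton _ _ _
  | succ n ih =>
    obtain ⟨i, rfl⟩ := Nat.exists_eq_add_of_le' (Nat.one_le_of_lt hi)
    suffices H : ∀ (N : Type u) [AddCommGroup N] [Module R N] [Module.Finite R N],
        Module.supportDim R N < (n + 1 : ℕ) →
        (∀ x ∈ powTorsion (maximalIdeal R) N, x = 0) →
        Subsingleton (genLocalCohomology R (maximalIdeal R) R N (i + 1)) by
      have := H (N ⧸ powTorsion (maximalIdeal R) N)
        ((Module.supportDim_le_of_surjective _ (Submodule.mkQ_surjective _)).trans_lt hn)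
        (powTorsion_quotient_eq_zero (maximalIdeal R) N)
      exact (map_mkQ_injective (maximalIdeal R) N i).subsingleton
    intro N _ _ _ hdim hN
    obtain ⟨r, hr, hreg, -⟩ := exists_isSMulRegular_notMem hN Set.finite_empty (by simp)
    have hd : Module.supportDim R (QuotSMulTop r N) < n := by
      rw [← Module.supportDim_quotSMulTop_succ_eq_supportDim hreg hr] at hdim
      push_cast at hdim
      exact lt_of_add_lt_add_right hdim
    have hsub := ih (QuotSMulTop r N) hd i (by lia)
    -- `H^i(N/rN) = 0` makes `r` injective on `H^{i+1}(N)`, yet each element is killed by a power of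
    -- `r`.
    have hinj : ∀ z : genLocalCohomology R (maximalIdeal R) R N (i + 1), r • z = 0 → z = 0 := by
      intro z hz
      obtain ⟨w, rfl⟩ := (exact_connecting_map _ _ (smul_id_injective hreg) (exact_smul_id_mkQ N r)
          (Submodule.mkQ_surjective _) i z).1 (by rw [map_smul_id, hz])
      have hw : w = 0 := hsub.elim _ _
      rw [hw, _root_.map_zero]
    have hpow : ∀ (k : ℕ) (z : genLocalCohomology R (maximalIdeal R) R N (i + 1)),
        r ^ k • z = 0 → z = 0 := by
      intro k
      induction k with
      | zero => intro z hz; rwa [pow_zero, one_smul] at hz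
      | succ k ihk =>
        intro z hz
        rw [pow_succ', mul_smul] at hz
        exact ihk z (hinj _ hz)
    refine subsingleton_of_forall_eq 0 fun z => ?_
    obtain ⟨k, hk⟩ := exists_pow_smul_eq_zero _ _ _ z
    exact hpow k z (hk _ (Ideal.pow_mem_pow hr k))

variable {N} in
lemma maximalIdeal_le_of_mem_support {p : PrimeSpectrum R}
    (hp : p ∈ Module.support R (powTorsion (maximalIdeal R) N)) : maximalIdeal R ≤ p.asIdeal := by
  obtain ⟨k, hk⟩ := exists_pow_smul_powTorsion_eq_zero (I := maximalIdeal R)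
    (IsNoetherian.noetherian (powTorsion (maximalIdeal R) N)) le_rfl
  exact p.2.le_of_pow_le fun a ha => Module.annihilator_le_of_mem_support hp
    (Module.mem_annihilator.2 fun x => Subtype.ext (hk a ha x x.2))

lemma supportDim_powTorsion_le_zero :
    Module.supportDim R (powTorsion (maximalIdeal R) N) ≤ 0 := by
  have : Subsingleton (Module.support R (powTorsion (maximalIdeal R) N)) :=
    ⟨fun p q => Subtype.ext (PrimeSpectrum.ext
      (((le_maximalIdeal p.1.2.ne_top).antisymm (maximalIdeal_le_of_mem_support p.2)).trans
        ((le_maximalIdeal q.1.2.ne_top).antisymm (maximalIdeal_le_of_mem_support q.2)).symm))⟩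
  exact Order.krullDim_nonpos_of_subsingleton

/-- The torsion is supported at most at `𝔪`, which already lies in the support of the nonzero
quotient. -/
lemma supportDim_quotient_powTorsion [Nontrivial (N ⧸ powTorsion (maximalIdeal R) N)] :
    Module.supportDim R (N ⧸ powTorsion (maximalIdeal R) N) = Module.supportDim R N := by
  have h : Module.support R N = Module.support R (N ⧸ powTorsion (maximalIdeal R) N) := by
    rw [Module.support_of_exact (exact_powTorsion_mkQ (maximalIdeal R) N)
      (Submodule.subtype_injective _) (Submodule.mkQ_surjective _), Set.union_eq_right]
    intro p hp
    obtain ⟨q, hq⟩ := Module.nonempty_support_of_nontrivial (R := R)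
      (M := N ⧸ powTorsion (maximalIdeal R) N)
    exact Module.mem_support_mono
      ((le_maximalIdeal q.2.ne_top).trans (maximalIdeal_le_of_mem_support hp)) hq
  rw [Module.supportDim, Module.supportDim, h]

/-- Otherwise `N / Γ(N)` is nonzero with a regular element in `𝔪`, so its dimension, which is that
of `N`, is at least 1. -/
lemma mem_powTorsion_of_supportDim_le_zero (h : Module.supportDim R N ≤ 0) (x : N) :
    x ∈ powTorsion (maximalIdeal R) N := by
  by_contra hx
  have : Nontrivial (N ⧸ powTorsion (maximalIdeal R) N) :=
    ⟨⟨Submodule.Quotient.mk x, 0, fun h => hx ((Submodule.Quotient.mk_eq_zero _).1 h)⟩⟩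
  obtain ⟨r, hr, hreg, -⟩ := exists_isSMulRegular_notMem
    (powTorsion_quotient_eq_zero (maximalIdeal R) N) Set.finite_empty (by simp)
  rw [← supportDim_quotient_powTorsion,
    ← Module.supportDim_quotSMulTop_succ_eq_supportDim hreg hr] at h
  have hne : Nontrivial (QuotSMulTop r (N ⧸ powTorsion (maximalIdeal R) N)) := by
    rw [← Module.supportDim_ne_bot_iff_nontrivial R]
    intro hbot
    have h1 := Module.supportDim_quotSMulTop_succ_eq_supportDim hreg hr
    rw [hbot, WithBot.bot_add] at h1
    exact Module.supportDim_ne_bot_of_nontrivial R _ h1.symm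
  obtain ⟨d, hd⟩ := WithBot.ne_bot_iff_exists.1 (Module.supportDim_ne_bot_of_nontrivial R
    (QuotSMulTop r (N ⧸ powTorsion (maximalIdeal R) N)))
  rw [← hd] at h
  have h' : d + 1 ≤ 0 := WithBot.coe_le_coe.1 h
  simp at h'

/-- **Grothendieck's non-vanishing theorem**, in a strong form: in positive degree, the top local
cohomology module of a finite module is not annihilated by a power of the maximal ideal. -/
theorem not_exists_pow_smul_eq_zero (n : ℕ) (hn : Module.supportDim R N = (n + 1 : ℕ)) (k : ℕ) :
    ∃ a ∈ maximalIdeal R ^ k,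
      ∃ z : genLocalCohomology R (maximalIdeal R) R N (n + 1), a • z ≠ 0 := by
  have reduce : ∀ n : ℕ,
      (∀ (N : Type u) [AddCommGroup N] [Module R N] [Module.Finite R N],
        (∀ x ∈ powTorsion (maximalIdeal R) N, x = 0) →
        Module.supportDim R N = (n + 1 : ℕ) → ∀ k : ℕ, ∃ a ∈ maximalIdeal R ^ k,
        ∃ z : genLocalCohomology R (maximalIdeal R) R N (n + 1), a • z ≠ 0) →
      ∀ (N : Type u) [AddCommGroup N] [Module R N] [Module.Finite R N],
        Module.supportDim R N = (n + 1 : ℕ) → ∀ k : ℕ, ∃ a ∈ maximalIdeal R ^ k,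
        ∃ z : genLocalCohomology R (maximalIdeal R) R N (n + 1), a • z ≠ 0 := by
    intro n H N _ _ _ hn k
    have : Nontrivial (N ⧸ powTorsion (maximalIdeal R) N) := by
      by_contra hs
      rw [not_nontrivial_iff_subsingleton, Submodule.Quotient.subsingleton_iff] at hs
      have hle := supportDim_powTorsion_le_zero (R := R) N
      rw [hs, Module.supportDim_eq_of_equiv Submodule.topEquiv, hn] at hle
      have hle' : ((n + 1 : ℕ) : ℕ∞) ≤ 0 := WithBot.coe_le_coe.1 hle
      simp at hle'
    obtain ⟨a, ha, z, hz⟩ := H _ (powTorsion_quotient_eq_zero (maximalIdeal R) N)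
      ((supportDim_quotient_powTorsion N).trans hn) k
    obtain ⟨w, rfl⟩ := map_mkQ_surjective (maximalIdeal R) N (n + 1) z
    exact ⟨a, ha, w, fun h => hz (by rw [← map_smul, h, _root_.map_zero])⟩
  induction n generalizing N k with
  | zero =>
    refine reduce 0 ?_ N hn k
    clear! N
    clear k
    intro N _ _ _ hN hn k
    by_contra! H
    obtain ⟨s, hs, hreg, -⟩ := exists_isSMulRegular_notMem hN Set.finite_empty (by simp)
    have hregk : IsSMulRegular N (s ^ (k + 1)) := hreg.pow _
    have hdim := Module.supportDim_quotSMulTop_succ_eq_supportDim hregk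
      (Ideal.pow_mem_of_mem _ hs _ k.succ_pos)
    rw [hn] at hdim
    have hdim0 : Module.supportDim R (QuotSMulTop (s ^ (k + 1)) N) ≤ 0 :=
      (eq_natCast_of_add_one_eq hdim).le
    have h0 : Subsingleton (genLocalCohomology R (maximalIdeal R) R N 0) :=
      (subsingleton_zero_iff_ring _ _).2 hN
    -- `N / s^(k+1) N` has dimension 0, so it is its own `H^0` and embeds in `H^1(N)`, which `s^k`
    -- kills. Cancelling `s^k` then gives `N = sN`, against the dimension formula.
    have hmem : ∀ y : N, s ^ k • y ∈ s ^ (k + 1) • (⊤ : Submodule R N) := by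
      intro y
      obtain ⟨z, hz⟩ := (mem_range_toHom_iff (maximalIdeal R) R (QuotSMulTop (s ^ (k + 1)) N)
        (LinearMap.toSpanSingleton R _ (Submodule.Quotient.mk y))).2
          (mem_powTorsion_linearMap fun r =>
            mem_powTorsion_of_supportDim_le_zero _ hdim0 _)
      have hz0 : s ^ k • z = 0 := by
        refine connecting_injective _ _ (smul_id_injective hregk) (exact_smul_id_mkQ N _)
          (Submodule.mkQ_surjective _) 0 h0 ?_
        rw [map_smul, H _ (Ideal.pow_mem_pow hs k), _root_.map_zero]
      have h1 : s ^ k • (LinearMap.toSpanSingleton R (QuotSMulTop (s ^ (k + 1)) N)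
          (Submodule.Quotient.mk y)) 1 = 0 := by
        rw [← hz, ← LinearMap.smul_apply, ← map_smul, hz0, _root_.map_zero, LinearMap.zero_apply]
      rw [LinearMap.toSpanSingleton_apply, one_smul, ← Submodule.Quotient.mk_smul] at h1
      exact (Submodule.Quotient.mk_eq_zero _).1 h1
    have htop : Subsingleton (QuotSMulTop s N) := by
      refine subsingleton_of_forall_eq 0 fun x => ?_
      obtain ⟨y, rfl⟩ := Submodule.mkQ_surjective _ x
      refine (Submodule.Quotient.mk_eq_zero _).2 ?_
      obtain ⟨w, -, hw⟩ := (Submodule.mem_smul_pointwise_iff_exists _ _ _).1 (hmem y)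
      rw [pow_succ, mul_smul] at hw
      exact (Submodule.mem_smul_pointwise_iff_exists _ _ _).2 ⟨w, trivial, hreg.pow k hw⟩
    have hbot := Module.supportDim_quotSMulTop_succ_eq_supportDim hreg hs
    rw [Module.supportDim_eq_bot_of_subsingleton, WithBot.bot_add, hn] at hbot
    exact WithBot.bot_ne_coe hbot
  | succ n ih =>
    refine reduce (n + 1) ?_ N hn k
    clear! N
    clear k
    intro N _ _ _ hN hn k
    by_contra! H
    have := isArtinian_genLocalCohomology (R := R) N (n + 1)
    -- Choose `r` regular on `N` and generic for `A = H^{n+1}(N)`, so that `𝔪^j A ⊆ rA`. If `𝔪^k`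
    -- kills `H^{n+2}(N)`, then `𝔪^k H^{n+1}(N/rN)` comes from `A`. The image of `rA` is zero, so
    -- `𝔪^(j+k)` kills `H^{n+1}(N/rN)`, against induction.
    obtain ⟨S, hS, hp, hj⟩ := exists_finite_primes_pow_smul_subset
      (A := genLocalCohomology R (maximalIdeal R) R N (n + 1)) (maximalIdeal R)
    obtain ⟨r, hr, hreg, hrS⟩ := exists_isSMulRegular_notMem hN hS hp
    obtain ⟨j, hj⟩ := hj r hrS
    have hdim := Module.supportDim_quotSMulTop_succ_eq_supportDim hreg hr
    rw [hn] at hdim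
    have hdim' : Module.supportDim R (QuotSMulTop r N) = (n + 1 : ℕ) :=
      eq_natCast_of_add_one_eq hdim
    obtain ⟨c, hc, z, hz⟩ := ih (QuotSMulTop r N) hdim' (j + k)
    refine hz (smul_eq_zero_of_mem_pow_add (fun b hb a ha => ?_) c hc)
    obtain ⟨w, hw⟩ := (exact_map_connecting (maximalIdeal R) R (smul_id_injective hreg)
      (exact_smul_id_mkQ N r) (Submodule.mkQ_surjective _) (n + 1) (a • z)).1
        (by rw [map_smul, H a ha])
    obtain ⟨v, hv⟩ := hj b hb w
    rw [mul_smul, ← hw, ← map_smul, hv, ← map_smul_id]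
    exact (exact_map_map (maximalIdeal R) R (smul_id_injective hreg)
      (exact_smul_id_mkQ N r) (Submodule.mkQ_surjective _) (n + 1)).apply_apply_eq_zero v

end Local

/-! ### Cohomological dimension as the dimension of `Hom` -/

lemma subsingleton_ext_of_extSup_le {M N : Type u} [AddCommGroup M] [Module R M]
    [AddCommGroup N] [Module R N] (h : extSup R M N ≤ 0) (j : ℕ) :
    Subsingleton (ExtMod R M N (j + 1)) := by
  by_contra hs
  rw [not_subsingleton_iff_nontrivial] at hs
  have h1 : ((j + 1 : ℕ) : WithBot ℕ∞) ≤ 0 := sSup_le_iff.1 h _ ⟨j + 1, hs, rfl⟩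
  have h2 : ((j + 1 : ℕ) : ℕ∞) ≤ 0 := WithBot.coe_le_coe.1 h1
  simp at h2

variable [IsNoetherianRing R] [IsLocalRing R]

/-- The top non-vanishing local cohomology module of a finite module sits in degree its
dimension. -/
theorem cd_ring_eq_supportDim (N : Type u) [AddCommGroup N] [Module R N] [Module.Finite R N] :
    cd R (maximalIdeal R) R N = Module.supportDim R N := by
  refine le_antisymm (sSup_le ?_) ?_
  · rintro _ ⟨i, hi, rfl⟩
    by_contra! h
    exact not_subsingleton_iff_nontrivial.2 hi (subsingleton_of_supportDim_lt N i h i le_rfl)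
  · rcases subsingleton_or_nontrivial N with h | h
    · rw [Module.supportDim_eq_bot_of_subsingleton]
      exact bot_le
    obtain ⟨d, hd⟩ := WithBot.ne_bot_iff_exists.1 (Module.supportDim_ne_bot_of_nontrivial R N)
    have htop : d ≠ ⊤ := by
      rintro rfl
      exact ((Module.supportDim_le_ringKrullDim R N).trans_lt ringKrullDim_lt_top).ne hd.symm
    obtain ⟨n, rfl⟩ := ENat.ne_top_iff_exists.1 htop
    refine le_sSup ⟨n, ?_, hd.symm⟩
    cases n with
    | zero =>
      rw [← not_subsingleton_iff_nontrivial, subsingleton_zero_iff_ring]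
      intro H
      obtain ⟨x, hx⟩ := exists_ne (0 : N)
      exact hx (H x (mem_powTorsion_of_supportDim_le_zero N hd.symm.le x))
    | succ n =>
      obtain ⟨a, -, z, hz⟩ := not_exists_pow_smul_eq_zero N n hd.symm 0
      exact ⟨⟨a • z, 0, hz⟩⟩

/-- If `Ext^j(M, N) = 0` for all `j > 0`, the cohomological dimension of the pair `M, N` is the
dimension of `Hom(M, N)`. -/
theorem cd_eq_supportDim_linearMap (M N : Type u) [AddCommGroup M] [Module R M]
    [Module.Finite R M] [AddCommGroup N] [Module R N] [Module.Finite R N]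
    (h : extSup R M N ≤ 0) :
    cd R (maximalIdeal R) M N = Module.supportDim R (M →ₗ[R] N) := by
  rw [← cd_ring_eq_supportDim, cd, cd]
  congr 1
  ext x
  refine exists_congr fun i => and_congr_left fun _ => ?_
  rw [← not_subsingleton_iff_nontrivial, ← not_subsingleton_iff_nontrivial,
    subsingleton_iff_subsingleton_linearMap _ M i N (subsingleton_ext_of_extSup_le h)]

-- Whatever annihilates `M` annihilates `Hom(M, N)`, and both modules are finite, so the supports
-- are nested.
omit [IsLocalRing R] in
lemma supportDim_linearMap_le (M N : Type u) [AddCommGroup M] [Module R M]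
    [Module.Finite R M] [AddCommGroup N] [Module R N] [Module.Finite R N] :
    Module.supportDim R (M →ₗ[R] N) ≤ Module.supportDim R M := by
  refine Order.krullDim_le_of_strictMono
    (Set.inclusion (s := Module.support R (M →ₗ[R] N)) (t := Module.support R M) ?_)
    fun _ _ h => h
  rw [Module.support_eq_zeroLocus, Module.support_eq_zeroLocus]
  refine PrimeSpectrum.zeroLocus_anti_mono fun a ha => ?_
  refine Module.mem_annihilator.2 fun f => ?_
  ext m
  rw [LinearMap.smul_apply, ← map_smul, Module.mem_annihilator.1 ha, map_zero,
    LinearMap.zero_apply]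

end GenLocalCohomology

end

open GenLocalCohomology in
theorem corollary3p8 (R : Type u) [CommRing R] [IsNoetherianRing R] [IsLocalRing R]
    (C : Type u) [AddCommGroup C] [Module R C]
    (hC : GenLocalCohomology.IsSemidualizing R C) :
    (∀ (M : Type u) [AddCommGroup M] [Module R M],
      GenLocalCohomology.IsTotallyReflexive R C M →
        GenLocalCohomology.cd R (maximalIdeal R) M C =
            GenLocalCohomology.cd R (maximalIdeal R) (M →ₗ[R] C) C ∧
          GenLocalCohomology.cd R (maximalIdeal R) (M →ₗ[R] C) C = Module.supportDim R M) ∧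
      GenLocalCohomology.cd R (maximalIdeal R) C C = ringKrullDim R := by
  have := hC.finite
  refine ⟨fun M _ _ hM => ?_, ?_⟩
  · have := hM.finite
    have hdual : Module.supportDim R ((M →ₗ[R] C) →ₗ[R] C) = Module.supportDim R M :=
      (Module.supportDim_eq_of_equiv
        (LinearEquiv.ofBijective LinearMap.applyₗ hM.biduality_bijective)).symm
    have hdim : Module.supportDim R (M →ₗ[R] C) = Module.supportDim R M :=
      (supportDim_linearMap_le M C).antisymm
        (hdual.symm.le.trans (supportDim_linearMap_le (M →ₗ[R] C) C))
    rw [cd_eq_supportDim_linearMap M C hM.extSup_le,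
      cd_eq_supportDim_linearMap (M →ₗ[R] C) C hM.extSup_dual_le, hdual, hdim]
    exact ⟨rfl, rfl⟩
  · rw [cd_eq_supportDim_linearMap C C hC.extSup_le, ← Module.supportDim_self_eq_ringKrullDim]
    exact (Module.supportDim_eq_of_equiv
      (LinearEquiv.ofBijective (LinearMap.lsmul R C) hC.homothety_bijective)).symm
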